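/- All spaces are real. Write $L_1=L_1[0,1]$, let $S(\ell_1)$ be the unit sphere of $\ell_1$, and identify $\ell_\infty$ with $\ell_1^*$ via $z(x)=\sum_n z_nx_n$. For $\tau\ge 1$, two normed spaces $X,Y$ are *$\tau$-isomorphic* if there are a bounded linear surjection $T\colon X\to Y$ and numbers $a>0$, $b$ with $ab=\tau$ and $a^{-1}\|x\|\le\|Tx\|\le b\|x\|$ for all $x\in X$. A subspace of $\ell_\infty=\ell_1^*$ is *total* if it is weak$^*$-dense in $\ell_\infty$. **Corollary 5.1.** Fix $\varepsilon,\eta>0$. Let $\mathcal Z_1$ be a total subspace of $\ell_\infty=\ell_1^*$ that is isomorphic (linearly homeomorphic) to $L_1$, and let $\mathcal Z_2$ be a subspace of $\mathcal Z_1$ that is $(1+\eta)$-isomorphic to $\ell_2$. Then there exist sequences $(x_n)_{n=1}^\infty$ in $S(\ell_1)$ and $(x_n^*)_{n=1}^\infty$ in $\ell_\infty$ such that 1. (biorthogonality) $x_n^*(x_m)=\delta_{nm}$ for all $n,m$; 2. ($[(1+\sqrt2)+\varepsilon]$-boundedness) $(x_n)$ and $(x_n^*)$ are bounded and $\sup_n\|x_n\|\,\|x_n^*\|\le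 (1+\sqrt2)+\varepsilon$; 3. (fundamentality) the closed linear span of $\{x_n\}_{n=1}^\infty$ is $\ell_1$; 4. $\displaystyle\sup_{n\in\mathbb N} d(x_n^*,\mathcal Z_2)<\eta$, where $d$ is the distance in the norm of $\ell_\infty$. -/

import Mathlib

open scoped ENNReal

noncomputable section

namespace BiorthogonalSystems

/-- The real sequence space `ℓ₁`. -/
abbrev EllOne : Type := lp (fun _ : ℕ => ℝ) 1

/-- The real sequence space `ℓ₂`. -/
abbrev EllTwo : Type := lp (fun _ : ℕ => ℝ) 2

/-- The real sequence space `ℓ_∞`. -/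
abbrev EllInfty : Type := lp (fun _ : ℕ => ℝ) ∞

/-- The real Lebesgue space `L₁ = L₁[0,1]`. -/
abbrev LOne : Type :=
  MeasureTheory.Lp ℝ 1 (MeasureTheory.volume.restrict (Set.Icc (0 : ℝ) 1))

/-- The canonical map `ℓ_∞ → ℓ₁*`, `z ↦ (x ↦ ∑ₙ zₙ xₙ)`. -/
def pairing : EllInfty →L[ℝ] StrongDual ℝ EllOne :=
  lp.dualPairing ∞ 1 (K := 1) (fun _ : ℕ => ContinuousLinearMap.mul ℝ ℝ)
    (fun _ => ContinuousLinearMap.opNorm_mul_le ℝ ℝ)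

theorem pairing_apply (z : EllInfty) (x : EllOne) : pairing z x = ∑' n, z n * x n := rfl

theorem pairing_single (z : EllInfty) (n : ℕ) :
    pairing z (lp.single 1 n (1 : ℝ)) = z n := by
  rw [pairing_apply, tsum_eq_single n]
  · simp
  · intro m hm
    simp [hm]

theorem norm_pairing (z : EllInfty) : ‖pairing z‖ = ‖z‖ := by
  apply le_antisymm
  · have h : ‖pairing‖ ≤ ((1 : NNReal) : ℝ) := lp.norm_dualPairing _ _
    simpa using pairing.le_of_opNorm_le h z
  · refine lp.norm_le_of_forall_le (norm_nonneg _) fun n => ?_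
    rw [← pairing_single z n]
    refine ((pairing z).le_opNorm _).trans ?_
    rw [lp.norm_single zero_lt_one]
    simp

theorem pairing_surjective : Function.Surjective pairing := by
  intro f
  have hb : ∀ n, ‖f (lp.single 1 n (1 : ℝ))‖ ≤ ‖f‖ := fun n => by
    refine (f.le_opNorm _).trans ?_
    rw [lp.norm_single zero_lt_one]
    simp
  let z : EllInfty := ⟨fun n => f (lp.single 1 n (1 : ℝ)),
    memℓp_infty ⟨‖f‖, by rintro _ ⟨n, rfl⟩; exact hb n⟩⟩
  refine ⟨z, ?_⟩
  ext x
  have h := (lp.hasSum_single (p := 1) (by simp) x).mapL f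
  rw [pairing_apply, ← h.tsum_eq]
  refine tsum_congr fun n => ?_
  have : lp.single (E := fun _ : ℕ => ℝ) 1 n (x n) = x n • lp.single 1 n (1 : ℝ) := by
    rw [← lp.single_smul]
    simp
  rw [this, map_smul, smul_eq_mul, mul_comm]

/-- The canonical isometric identification `ℓ_∞ = ℓ₁*`. -/
def ellInftyEquivDual : EllInfty ≃ₗᵢ[ℝ] StrongDual ℝ EllOne :=
  LinearIsometryEquiv.ofSurjective ⟨pairing.toLinearMap, norm_pairing⟩ pairing_surjective

theorem ellInftyEquivDual_apply (z : EllInfty) (x : EllOne) :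
    ellInftyEquivDual z x = ∑' n, z n * x n := rfl

/-- `X` and `Y` are `τ`-isomorphic: `τ = a * b` for some `a > 0` and `b`, and there is a bounded
linear surjection `T : X → Y` with `a⁻¹ ‖x‖ ≤ ‖T x‖ ≤ b ‖x‖` for all `x`. -/
def IsIsomorphicWith (τ : ℝ) (X Y : Type*) [NormedAddCommGroup X] [NormedSpace ℝ X]
    [NormedAddCommGroup Y] [NormedSpace ℝ Y] : Prop :=
  ∃ (T : X →L[ℝ] Y) (a b : ℝ), 0 < a ∧ a * b = τ ∧ Function.Surjective T ∧
    ∀ x, a⁻¹ * ‖x‖ ≤ ‖T x‖ ∧ ‖T x‖ ≤ b * ‖x‖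

section General

variable {X : Type*} [NormedAddCommGroup X] [NormedSpace ℝ X]

/-- A set of functionals is total: its linear span is weak*-dense in the dual. -/
def IsTotalSet (Z : Set (StrongDual ℝ X)) : Prop :=
  closure (StrongDual.toWeakDual '' (Submodule.span ℝ Z : Set (StrongDual ℝ X))) = Set.univ

/-- A set of vectors is fundamental: its closed linear span is the whole space. -/
def IsFundamental (S : Set X) : Prop :=
  (Submodule.span ℝ S).topologicalClosure = ⊤

/-- `x_n^*(x_m) = δ_{nm}`. -/
def IsBiorthogonal (x : ℕ → X) (f : ℕ → StrongDual ℝ X) : Prop :=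
  ∀ n m, f n (x m) = if n = m then 1 else 0

/-- `M`-boundedness: both sequences are bounded, and `‖x_n‖ ‖x_n^*‖ ≤ M` for all `n`. -/
def IsBoundedBy (M : ℝ) (x : ℕ → X) (f : ℕ → StrongDual ℝ X) : Prop :=
  Bornology.IsBounded (Set.range x) ∧ Bornology.IsBounded (Set.range f) ∧
    ∀ n, ‖x n‖ * ‖f n‖ ≤ M

end General

end BiorthogonalSystems

end

open BiorthogonalSystems

open Filter Topology

namespace BiorthogonalSystems

/-! An orthonormal sequence in a copy of ℓ₂ supplies pairs (vector of norm about 1, functional near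
the copy) that are almost biorthogonal to any given finite system of pairs. They are used to average
away bad pairs.

Let `u` be an arbitrary pair and `q` a fresh supplied pair, biorthogonal to `u` and to the system
built so far. The rotated pairs `(u + q)/√2` and `(u - q)/√2` are again biorthogonal and their
vectors span that of `u`. Under this step a bound `r` on the norm of the vector becomes about `(r +
1)/√2`, whose fixed point is `1 + √2`: this is the source of the constant. The functional's distance
from the copy contracts likewise, while near-orthogonality in ℓ₂ keeps its ℓ₂ part of norm about 1
(`isControlled_child`). Iterating on both halves drives the excess to 0
(`SpreadingData.exists_spread`).

Applied in turn to the remainders of the unit vectors of ℓ₁, this gives a fundamental system.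
`exists_orthonormal_almost_norming` removes the distortion of the copy, and
`exists_almostBiorthogonal` produces the supply. -/

/-! ### Operators on ℓ₂ restricted to finite codimension -/

theorem not_finiteDimensional_ellTwo : ¬ FiniteDimensional ℝ EllTwo := by
  intro h
  let b : HilbertBasis ℕ ℝ EllTwo := ⟨LinearIsometryEquiv.refl ℝ _⟩
  have := b.orthonormal.linearIndependent.finite
  exact not_finite ℕ

theorem exists_unit_mem_orthogonal (W : Submodule ℝ EllTwo) [FiniteDimensional ℝ W] :
    ∃ h ∈ Wᗮ, ‖h‖ = 1 := by
  have hne : Wᗮ ≠ ⊥ := by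
    rw [Ne, Submodule.orthogonal_eq_bot_iff]
    rintro rfl
    exact not_finiteDimensional_ellTwo (Module.Finite.equiv (Submodule.topEquiv (R := ℝ)))
  obtain ⟨h, hh, h0⟩ := Submodule.exists_mem_ne_zero_of_ne_bot hne
  refine ⟨‖h‖⁻¹ • h, Submodule.smul_mem _ _ hh, ?_⟩
  rw [norm_smul, norm_inv, norm_norm, inv_mul_cancel₀ (norm_ne_zero_iff.2 h0)]

/-- On a suitable finite-codimensional subspace an operator bounded below on `ℓ₂` is, up to scaling,
almost a contraction, while it nearly attains its norm at the terms of an orthonormal sequence. -/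
theorem exists_orthonormal_almost_norming {E : Type*} [NormedAddCommGroup E] [NormedSpace ℝ E]
    (S : EllTwo →L[ℝ] E) {κ : ℝ} (hκ : 0 < κ) (hS : ∀ h, κ * ‖h‖ ≤ ‖S h‖)
    {δ : ℝ} (hδ : 0 < δ) (hδ1 : δ ≤ 1) :
    ∃ (t : ℝ) (V : Submodule ℝ EllTwo) (h : ℕ → EllTwo), Orthonormal ℝ h ∧ (∀ n, h n ∈ V) ∧
      (∀ g ∈ V, ‖(t • S) g‖ ≤ (1 + δ) * ‖g‖) ∧ ∀ n, 1 < ‖(t • S) (h n)‖ := by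
  -- The infimum of `Q` is the asymptotic norm of `S`: the least norm over restrictions to
  -- finite-codimensional subspaces. The lower bound on `S` makes it positive.
  let Q : Set ℝ := {r | ∃ W : Submodule ℝ EllTwo, FiniteDimensional ℝ W ∧
    ∀ h ∈ Wᗮ, ‖S h‖ ≤ r * ‖h‖}
  have hQne : Q.Nonempty := ⟨‖S‖, ⊥, inferInstance, fun h _ => S.le_opNorm h⟩
  have hQκ : ∀ r ∈ Q, κ ≤ r := by
    rintro r ⟨W, hW, hr⟩
    obtain ⟨h, hh, h1⟩ := exists_unit_mem_orthogonal W
    simpa [h1] using (hS h).trans (hr h hh)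
  have hQb : BddBelow Q := ⟨κ, hQκ⟩
  set M := sInf Q with hM
  have hMpos : 0 < M := hκ.trans_le (le_csInf hQne hQκ)
  have hd : 1 < 1 + δ / 3 := by linarith
  have hd0 : 0 < 1 + δ / 3 := by linarith
  obtain ⟨r, ⟨W, hW, hr⟩, hrM⟩ := exists_lt_of_csInf_lt hQne
    (show M < M * (1 + δ / 3) by nlinarith)
  -- Just below the infimum, `q` is exceeded on every finite-codimensional subspace. Scaling by
  -- `q⁻¹` costs `(1 + δ/3)² ≤ 1 + δ`.
  set q := M / (1 + δ / 3) with hq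
  have hq0 : 0 < q := by positivity
  have hqM : q < M := div_lt_self hMpos hd
  have key : ∀ W' : Submodule ℝ EllTwo, FiniteDimensional ℝ W' →
      ∃ h ∈ W'ᗮ, ‖h‖ = 1 ∧ q < ‖S h‖ := by
    intro W' hW'
    have : q ∉ Q := fun hmem => absurd (csInf_le hQb hmem) (not_le.2 hqM)
    have h2 : ¬ ∀ h ∈ W'ᗮ, ‖S h‖ ≤ q * ‖h‖ := fun h => this ⟨W', hW', h⟩
    push Not at h2
    obtain ⟨h, hh, hlt⟩ := h2
    have h0 : 0 < ‖h‖ := by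
      rw [norm_pos_iff]
      rintro rfl
      simp at hlt
    refine ⟨‖h‖⁻¹ • h, Submodule.smul_mem _ _ hh, ?_, ?_⟩
    · rw [norm_smul, norm_inv, norm_norm, inv_mul_cancel₀ h0.ne']
    · rw [map_smul, norm_smul, norm_inv, norm_norm, inv_mul_eq_div, lt_div_iff₀ h0]
      exact hlt
  obtain ⟨f, hf, hfr⟩ := exists_seq_of_forall_finset_exists
    (fun h : EllTwo => h ∈ Wᗮ ∧ ‖h‖ = 1 ∧ q < ‖S h‖) (fun a b => inner ℝ a b = 0) (by
      intro s _
      obtain ⟨h, hh, h1, hlt⟩ := key (W ⊔ Submodule.span ℝ (s : Set EllTwo)) inferInstance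
      refine ⟨h, ⟨Submodule.orthogonal_le le_sup_left hh, h1, hlt⟩, fun x hx => ?_⟩
      exact (Submodule.mem_orthogonal _ _).1 hh x
        (Submodule.mem_sup_right (Submodule.subset_span hx)))
  refine ⟨q⁻¹, Wᗮ, f, ⟨fun n => (hf n).2.1, fun m n hmn => ?_⟩, fun n => (hf n).1, ?_, ?_⟩
  · rcases lt_or_gt_of_ne hmn with h | h
    · exact hfr m n h
    · rw [real_inner_comm]
      exact hfr n m h
  · intro g hg
    rw [_root_.smul_apply, norm_smul, norm_inv, Real.norm_of_nonneg hq0.le,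
      inv_mul_eq_div, div_le_iff₀ hq0]
    refine (hr g hg).trans ?_
    have h1 : r ≤ (1 + δ) * q := by
      refine hrM.le.trans ?_
      rw [hq, mul_div_assoc', le_div_iff₀ hd0]
      nlinarith [mul_pos hMpos hδ]
    calc r * ‖g‖ ≤ ((1 + δ) * q) * ‖g‖ := by gcongr
      _ = _ := by ring
  · intro n
    rw [_root_.smul_apply, norm_smul, norm_inv, Real.norm_of_nonneg hq0.le,
      inv_mul_eq_div, lt_div_iff₀ hq0]
    simpa using (hf n).2.2

/-- Bessel's inequality: orthonormal sequences are weakly null. -/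
theorem tendsto_apply_of_orthonormal {h : ℕ → EllTwo} (hh : Orthonormal ℝ h)
    (φ : StrongDual ℝ EllTwo) : Tendsto (fun n => φ (h n)) atTop (𝓝 0) := by
  have h1 := (hh.inner_products_summable
    ((InnerProductSpace.toDual ℝ EllTwo).symm φ)).tendsto_atTop_zero
  have h2 : ∀ n, inner ℝ (h n) ((InnerProductSpace.toDual ℝ EllTwo).symm φ) = φ (h n) := by
    intro n
    rw [real_inner_comm, InnerProductSpace.toDual_symm_apply]
  simp only [h2] at h1
  have h3 := h1.sqrt
  simp only [Real.sqrt_sq (norm_nonneg _), Real.sqrt_zero] at h3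
  exact tendsto_zero_iff_norm_tendsto_zero.2 h3

/-! ### Almost biorthogonal sequences in ℓ₁ and ℓ_∞ -/

theorem abs_pairing_le (z : EllInfty) (x : EllOne) : |pairing z x| ≤ ‖z‖ * ‖x‖ := by
  rw [← norm_pairing z]
  exact (pairing z).le_opNorm x

/-- For a fixed vector of `ℓ₁`, the pairing as a functional on `ℓ_∞`. -/
noncomputable def pairingLeft (x : EllOne) : StrongDual ℝ EllInfty :=
  (ContinuousLinearMap.apply ℝ ℝ x).comp pairing

theorem pairingLeft_apply (x : EllOne) (z : EllInfty) : pairingLeft x z = pairing z x := rfl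

theorem norm_pairingLeft_le (x : EllOne) : ‖pairingLeft x‖ ≤ ‖x‖ :=
  ContinuousLinearMap.opNorm_le_bound _ (norm_nonneg _) fun z => by
    rw [mul_comm]
    exact abs_pairing_le z x

/-- A bounded sequence in `ℓ₁` has an ultrafilter limit as a sequence of functionals on `ℓ_∞`. -/
theorem exists_limit_functional {g : ℕ → EllOne} (hg : ∀ n, ‖g n‖ ≤ 1) (l : Ultrafilter ℕ) :
    ∃ c : StrongDual ℝ EllInfty, ∀ z, Tendsto (fun n => pairing z (g n)) l (𝓝 (c z)) := by
  obtain ⟨c, -, hc⟩ :=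
    (WeakDual.isCompact_closedBall (𝕜 := ℝ) (E := EllInfty) 0 1).ultrafilter_le_nhds'
    (l.map fun n => StrongDual.toWeakDual (pairingLeft (g n))) (by
      rw [Ultrafilter.mem_map]
      refine Filter.univ_mem' fun n => ?_
      simpa using (norm_pairingLeft_le (g n)).trans (hg n))
  refine ⟨WeakDual.toStrongDual c, fun z => ?_⟩
  have h1 : Tendsto (fun n => StrongDual.toWeakDual (pairingLeft (g n))) l (𝓝 c) := hc
  exact ((WeakDual.eval_continuous z).tendsto c).comp h1

/-- Vectors `g n` in the unit ball of `ℓ₁` that are nearly biorthogonal, along the filter `l`, to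
functionals `y n` asymptotic to the sequence `w n`. -/
structure AlmostBiorthogonal (l : Filter ℕ) (w y : ℕ → EllInfty) (g : ℕ → EllOne) : Prop where
  norm_le : ∀ n, ‖g n‖ ≤ 1
  diag : Tendsto (fun n => pairing (y n) (g n)) l (𝓝 1)
  left : ∀ k, Tendsto (fun n => pairing (y k) (g n)) l (𝓝 0)
  right : ∀ x, Tendsto (fun n => pairing (y n) x) l (𝓝 0)
  close : Tendsto (fun n => ‖y n - w n‖) l (𝓝 0)
  coord : ∀ i, Tendsto (fun n => g n i) l (𝓝 0)

/-- Scaled unit vectors `g n` norm the `S (h n)`, but a fixed `S (h k)` need not vanish along them.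
Its ultrafilter limit `c (S (h k))` is removed by subtracting a multiple of one fixed `u`. This
correction is asymptotically free, as `S (h n)` is weakly null. -/
theorem exists_almostBiorthogonal (S : EllTwo →L[ℝ] EllInfty) {h : ℕ → EllTwo}
    (hh : Orthonormal ℝ h) (hS : ∀ n, 1 < ‖S (h n)‖) :
    ∃ (l : Ultrafilter ℕ) (y : ℕ → EllInfty) (g : ℕ → EllOne),
      (l : Filter ℕ) ≤ atTop ∧ AlmostBiorthogonal l (fun n => S (h n)) y g := by
  have hj : ∀ n, ∃ j, 1 < |S (h n) j| := by
    intro n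
    by_contra! hcon
    exact absurd (lp.norm_le_of_forall_le zero_le_one hcon) (not_le.2 (hS n))
  choose j hj using hj
  let g : ℕ → EllOne := fun n => (S (h n) (j n))⁻¹ • lp.single 1 (j n) (1 : ℝ)
  have hg : ∀ n, ‖g n‖ ≤ 1 := by
    intro n
    rw [norm_smul, lp.norm_single zero_lt_one, norm_inv, norm_one, mul_one, Real.norm_eq_abs]
    exact inv_le_one_of_one_le₀ (hj n).le
  have hpair : ∀ n z, pairing z (g n) = (S (h n) (j n))⁻¹ * z (j n) := by
    intro n z
    rw [map_smul, pairing_single, smul_eq_mul]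
  have hnull : ∀ φ : StrongDual ℝ EllInfty, Tendsto (fun n => φ (S (h n))) atTop (𝓝 0) :=
    fun φ => tendsto_apply_of_orthonormal hh (φ.comp S)
  let l : Ultrafilter ℕ := hyperfilter ℕ
  have hl : (l : Filter ℕ) ≤ atTop := Nat.hyperfilter_le_atTop
  obtain ⟨c, hc⟩ := exists_limit_functional hg l
  -- Either `c` vanishes on the whole sequence and `u = 0` serves, or `u` is normalised so that `c u
  -- = 1`.
  obtain ⟨u, hu⟩ : ∃ u : EllInfty, ∀ n, c (S (h n) - c (S (h n)) • u) = 0 := by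
    by_cases h0 : ∀ n, c (S (h n)) = 0
    · exact ⟨0, fun n => by simp [h0]⟩
    · push Not at h0
      obtain ⟨k, hk⟩ := h0
      exact ⟨(c (S (h k)))⁻¹ • S (h k), fun n => by simp [hk]⟩
  have hcn : Tendsto (fun n => c (S (h n))) l (𝓝 0) := (hnull c).mono_left hl
  refine ⟨l, fun n => S (h n) - c (S (h n)) • u, g, hl, hg, ?_, ?_, ?_, ?_, ?_⟩
  · have h1 : ∀ n, pairing (S (h n) - c (S (h n)) • u) (g n)
        = 1 - c (S (h n)) * pairing u (g n) := by
      intro n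
      have : S (h n) (j n) ≠ 0 := by
        intro h0
        have := hj n
        rw [h0] at this
        norm_num at this
      simp only [map_sub, map_smul, _root_.sub_apply, _root_.smul_apply,
        smul_eq_mul]
      rw [hpair n (S (h n)), inv_mul_cancel₀ this]
    simp only [h1]
    simpa using tendsto_const_nhds.sub (hcn.mul (hc u))
  · intro k
    have := hc (S (h k) - c (S (h k)) • u)
    rwa [hu] at this
  · intro x
    have h1 : Tendsto (fun n => pairing (S (h n)) x - c (S (h n)) * pairing u x) l (𝓝 0) := by
      simpa [pairingLeft_apply] using ((hnull (pairingLeft x)).mono_left hl).sub (hcn.mul_const (pairing u x))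
    simpa using h1
  · have h1 : Tendsto (fun n => |c (S (h n))| * ‖u‖) l (𝓝 0) := by
      simpa using hcn.abs.mul_const ‖u‖
    simpa [norm_smul] using h1
  · intro i
    refine Tendsto.congr' ?_ (tendsto_const_nhds (x := (0 : ℝ)))
    have h1 : Tendsto (fun n => S (h n) i) atTop (𝓝 0) := by
      refine (hnull (pairingLeft (lp.single 1 i (1 : ℝ)))).congr fun n => ?_
      rw [pairingLeft_apply, pairing_single]
    have h2 := (h1.abs.eventually (gt_mem_nhds (show |(0 : ℝ)| < 1 by simp)))
    filter_upwards [hl h2] with n hn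
    -- Coordinate `i` of `S (h n)` tends to 0, whereas coordinate `j n` exceeds 1 in modulus.
    have hne : i ≠ j n := by
      rintro rfl
      exact absurd hn (not_lt.2 (hj n).le)
    simp [g, hne]

/-! ### Finite biorthogonal systems and their remainders -/

/-- Two vector-functional pairs annihilate each other. -/
def MutuallyOrthogonal (p q : EllOne × EllInfty) : Prop :=
  pairing p.2 q.1 = 0 ∧ pairing q.2 p.1 = 0

theorem MutuallyOrthogonal.symm {p q : EllOne × EllInfty} (h : MutuallyOrthogonal p q) :
    MutuallyOrthogonal q p := ⟨h.2, h.1⟩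

theorem MutuallyOrthogonal.add {p q r : EllOne × EllInfty} (hq : MutuallyOrthogonal p q)
    (hr : MutuallyOrthogonal p r) : MutuallyOrthogonal p (q + r) := by
  constructor
  · rw [Prod.fst_add, map_add, hq.1, hr.1, add_zero]
  · rw [Prod.snd_add, map_add, _root_.add_apply, hq.2, hr.2, add_zero]

theorem MutuallyOrthogonal.smul {p q : EllOne × EllInfty} (hq : MutuallyOrthogonal p q) (t : ℝ) :
    MutuallyOrthogonal p (t • q) := by
  constructor
  · rw [Prod.smul_fst, map_smul, hq.1, smul_zero]
  · rw [Prod.smul_snd, map_smul, _root_.smul_apply, hq.2, smul_zero]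

theorem MutuallyOrthogonal.neg {p q : EllOne × EllInfty} (hq : MutuallyOrthogonal p q) :
    MutuallyOrthogonal p (-q) := by
  simpa using hq.smul (-1)

theorem pairing_smul_add {u q : EllOne × EllInfty} {t : ℝ} (ht : t * t = 1 / 2)
    (hu : pairing u.2 u.1 = 1) (hq : pairing q.2 q.1 = 1) (h : MutuallyOrthogonal u q) :
    pairing (t • (u + q)).2 (t • (u + q)).1 = 1 := by
  rw [Prod.smul_fst, Prod.smul_snd, Prod.fst_add, Prod.snd_add, map_smul, map_smul, map_add,
    map_add, _root_.smul_apply, _root_.smul_apply, _root_.add_apply, _root_.add_apply, hu, hq, h.1,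
    h.2, smul_eq_mul, smul_eq_mul]
  linear_combination 2 * ht

theorem mutuallyOrthogonal_sub_add {u q : EllOne × EllInfty} (t : ℝ)
    (hu : pairing u.2 u.1 = 1) (hq : pairing q.2 q.1 = 1) (h : MutuallyOrthogonal u q) :
    MutuallyOrthogonal (t • (u + -q)) (t • (u + q)) := by
  refine MutuallyOrthogonal.smul (MutuallyOrthogonal.symm (MutuallyOrthogonal.smul ?_ t)) t
  constructor
  · rw [Prod.fst_add, Prod.snd_add, Prod.fst_neg, map_add, map_add, map_neg, _root_.add_apply,
      _root_.add_apply, hu, hq, h.1, h.2]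
    norm_num
  · rw [Prod.fst_add, Prod.snd_add, Prod.snd_neg, map_add, map_add, map_neg, _root_.add_apply,
      _root_.add_apply, _root_.neg_apply, _root_.neg_apply, hu, hq, h.1, h.2]
    norm_num

/-- A set of vector-functional pairs is a biorthogonal system. -/
def IsBiorthogonalSet (A : Set (EllOne × EllInfty)) : Prop :=
  (∀ p ∈ A, pairing p.2 p.1 = 1) ∧ A.Pairwise MutuallyOrthogonal

theorem IsBiorthogonalSet.union {A B : Set (EllOne × EllInfty)} (hA : IsBiorthogonalSet A)
    (hB : IsBiorthogonalSet B) (hAB : ∀ p ∈ A, ∀ q ∈ B, MutuallyOrthogonal p q) :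
    IsBiorthogonalSet (A ∪ B) := by
  refine ⟨?_, ?_⟩
  · rintro p (hp | hp)
    exacts [hA.1 p hp, hB.1 p hp]
  · rintro p (hp | hp) q (hq | hq) hne
    exacts [hA.2 hp hq hne, hAB p hp q hq, (hAB q hq p hp).symm, hB.2 hp hq hne]

theorem isBiorthogonalSet_singleton {u : EllOne × EllInfty} (hu : pairing u.2 u.1 = 1) :
    IsBiorthogonalSet {u} :=
  ⟨by rintro p rfl; exact hu, Set.pairwise_singleton _ _⟩

theorem IsBiorthogonalSet.insert {A : Set (EllOne × EllInfty)} (hA : IsBiorthogonalSet A)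
    {u : EllOne × EllInfty} (hu : pairing u.2 u.1 = 1) (hAu : ∀ p ∈ A, MutuallyOrthogonal p u) :
    IsBiorthogonalSet (Insert.insert u A) := by
  rw [← Set.union_singleton]
  refine hA.union (isBiorthogonalSet_singleton hu) ?_
  rintro p hp _ rfl
  exact hAu p hp

/-- The part of a vector annihilated by the functionals of a finite system. -/
noncomputable def vecRemainder (A : Finset (EllOne × EllInfty)) (x : EllOne) : EllOne :=
  x - ∑ p ∈ A, pairing p.2 x • p.1

/-- The part of a functional vanishing on the vectors of a finite system. -/
noncomputable def funRemainder (A : Finset (EllOne × EllInfty)) (f : EllInfty) : EllInfty :=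
  f - ∑ p ∈ A, pairing f p.1 • p.2

theorem pairing_vecRemainder {A : Finset (EllOne × EllInfty)} (f : EllInfty) (x : EllOne) :
    pairing f (vecRemainder A x) = pairing f x - ∑ p ∈ A, pairing p.2 x * pairing f p.1 := by
  simp [vecRemainder, map_sum]

theorem pairing_funRemainder {A : Finset (EllOne × EllInfty)} (f : EllInfty) (x : EllOne) :
    pairing (funRemainder A f) x = pairing f x - ∑ p ∈ A, pairing f p.1 * pairing p.2 x := by
  simp [funRemainder, map_sum]

theorem pairing_mem_vecRemainder {A : Finset (EllOne × EllInfty)}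
    (hA : IsBiorthogonalSet (A : Set (EllOne × EllInfty))) {q : EllOne × EllInfty} (hq : q ∈ A)
    (x : EllOne) : pairing q.2 (vecRemainder A x) = 0 := by
  rw [pairing_vecRemainder, Finset.sum_eq_single_of_mem q hq, hA.1 q hq, mul_one, sub_self]
  intro p hp hne
  rw [(hA.2 hp hq hne).2, mul_zero]

theorem pairing_funRemainder_mem {A : Finset (EllOne × EllInfty)}
    (hA : IsBiorthogonalSet (A : Set (EllOne × EllInfty))) {q : EllOne × EllInfty} (hq : q ∈ A)
    (f : EllInfty) : pairing (funRemainder A f) q.1 = 0 := by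
  rw [pairing_funRemainder, Finset.sum_eq_single_of_mem q hq, hA.1 q hq, mul_one, sub_self]
  intro p hp hne
  rw [(hA.2 hp hq hne).1, mul_zero]

theorem pairing_funRemainder_vecRemainder {A : Finset (EllOne × EllInfty)}
    (hA : IsBiorthogonalSet (A : Set (EllOne × EllInfty))) (f : EllInfty) (x : EllOne) :
    pairing (funRemainder A f) (vecRemainder A x) = pairing f (vecRemainder A x) := by
  rw [pairing_funRemainder, Finset.sum_eq_zero, sub_zero]
  intro p hp
  rw [pairing_mem_vecRemainder hA hp, mul_zero]

/-! ### Adding a fresh pair to a finite system -/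

/-- The functionals tending to zero along `g`. -/
def nullFunctionals (l : Filter ℕ) (g : ℕ → EllOne) : Submodule ℝ EllInfty where
  carrier := {f | Tendsto (fun n => pairing f (g n)) l (𝓝 0)}
  zero_mem' := by simpa using tendsto_const_nhds
  add_mem' {a b} ha hb := by
    simpa using Tendsto.add (show Tendsto (fun n => pairing a (g n)) l (𝓝 0) from ha) hb
  smul_mem' c a ha := by
    simpa using Tendsto.const_mul c (show Tendsto (fun n => pairing a (g n)) l (𝓝 0) from ha)

theorem mem_nullFunctionals {l : Filter ℕ} {g : ℕ → EllOne} {f : EllInfty} :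
    f ∈ nullFunctionals l g ↔ Tendsto (fun n => pairing f (g n)) l (𝓝 0) := Iff.rfl

theorem funRemainder_mem_nullFunctionals {l : Filter ℕ} {g : ℕ → EllOne}
    {A : Finset (EllOne × EllInfty)} (hA : ∀ p ∈ A, p.2 ∈ nullFunctionals l g) {f : EllInfty}
    (hf : f ∈ nullFunctionals l g) : funRemainder A f ∈ nullFunctionals l g :=
  Submodule.sub_mem _ hf (Submodule.sum_mem _ fun p hp => Submodule.smul_mem _ _ (hA p hp))

/-- A finite biorthogonal system can be enlarged by a pair close to a term of an almost biorthogonal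
sequence, chosen with any prescribed eventual property. -/
theorem AlmostBiorthogonal.exists_pair {l : Filter ℕ} [l.NeBot] {w y : ℕ → EllInfty}
    {g : ℕ → EllOne} (H : AlmostBiorthogonal l w y g) {A : Finset (EllOne × EllInfty)}
    (hA : IsBiorthogonalSet (A : Set (EllOne × EllInfty)))
    (hAn : ∀ p ∈ A, p.2 ∈ nullFunctionals l g) {δ : ℝ} (hδ : 0 < δ) {P : ℕ → Prop}
    (hP : ∀ᶠ n in l, P n) :
    ∃ (n : ℕ) (q : EllOne × EllInfty), P n ∧ pairing q.2 q.1 = 1 ∧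
      (∀ p ∈ A, MutuallyOrthogonal p q) ∧ q.2 ∈ nullFunctionals l g ∧ ‖q.1‖ ≤ 1 + δ ∧
      ‖q.2 - w n‖ ≤ δ := by
  -- Projecting off `A` is asymptotically harmless: its functionals are null along `g`, and `y n` is
  -- weak*-null on its vectors.
  have h1 : Tendsto (fun n => pairing (y n) (vecRemainder A (g n))) l (𝓝 1) := by
    simp only [pairing_vecRemainder]
    have := H.diag.sub (tendsto_finsetSum A fun p hp =>
      (mem_nullFunctionals.1 (hAn p hp)).mul (H.right p.1))
    simpa using this
  have h2 : Tendsto (fun n => (pairing (y n) (vecRemainder A (g n)))⁻¹ *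
      (1 + ∑ p ∈ A, |pairing p.2 (g n)| * ‖p.1‖)) l (𝓝 1) := by
    have := (h1.inv₀ one_ne_zero).mul ((tendsto_finsetSum A fun p hp =>
      ((mem_nullFunctionals.1 (hAn p hp)).abs.mul_const ‖p.1‖)).const_add 1)
    simpa using this
  have h3 : Tendsto (fun n => ‖y n - w n‖ + ∑ p ∈ A, |pairing (y n) p.1| * ‖p.2‖) l (𝓝 0) := by
    have := H.close.add (tendsto_finsetSum A fun p _ => ((H.right p.1).abs.mul_const ‖p.2‖))
    simpa using this
  obtain ⟨n, hn1, hn2, hn3, hPn⟩ := ((h1.eventually (lt_mem_nhds one_pos)).and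
    ((h2.eventually (gt_mem_nhds (show 1 < 1 + δ by linarith))).and
    ((h3.eventually (gt_mem_nhds hδ)).and hP))).exists
  set s := pairing (y n) (vecRemainder A (g n)) with hs
  refine ⟨n, (s⁻¹ • vecRemainder A (g n), funRemainder A (y n)), hPn, ?_, fun p hp => ⟨?_, ?_⟩,
    funRemainder_mem_nullFunctionals hAn (H.left n), ?_, ?_⟩
  · rw [map_smul, pairing_funRemainder_vecRemainder hA, smul_eq_mul, inv_mul_cancel₀ hn1.ne']
  · rw [map_smul, pairing_mem_vecRemainder hA hp, smul_zero]
  · exact pairing_funRemainder_mem hA hp _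
  · rw [norm_smul, norm_inv, Real.norm_of_nonneg hn1.le]
    refine le_trans ?_ hn2.le
    gcongr
    refine (norm_sub_le _ _).trans (add_le_add (H.norm_le n) ((norm_sum_le _ _).trans ?_))
    exact Finset.sum_le_sum fun p _ => by rw [norm_smul, Real.norm_eq_abs]
  · refine le_trans ?_ hn3.le
    have : funRemainder A (y n) - w n = (y n - w n) - ∑ p ∈ A, pairing (y n) p.1 • p.2 := by
      rw [funRemainder]
      abel
    rw [this]
    refine (norm_sub_le _ _).trans (add_le_add le_rfl ((norm_sum_le _ _).trans ?_))
    exact Finset.sum_le_sum fun p _ => by rw [norm_smul, Real.norm_eq_abs]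

/-! ### Splitting and spreading by rotations -/

/-- The vector has norm about `1 + √2` and the functional is close to the image of a nearly unit
vector of `V`, both up to an excess `R`. -/
def IsControlled (S : EllTwo →L[ℝ] EllInfty) (V : Submodule ℝ EllTwo) (δ R : ℝ)
    (u : EllOne × EllInfty) : Prop :=
  ‖u.1‖ ≤ (1 + √2) * (1 + δ) + R ∧
    ∃ k ∈ V, ‖k‖ ^ 2 ≤ 1 + δ ∧ ‖u.2 - S k‖ ≤ 3 * δ + R

theorem IsControlled.mono {S : EllTwo →L[ℝ] EllInfty} {V : Submodule ℝ EllTwo} {δ R R' : ℝ}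
    {u : EllOne × EllInfty} (h : IsControlled S V δ R u) (hR : R ≤ R') :
    IsControlled S V δ R' u :=
  ⟨h.1.trans (by linarith), let ⟨k, hk, h1, h2⟩ := h.2; ⟨k, hk, h1, h2.trans (by linarith)⟩⟩

/-- The bounds in `IsControlled` are chosen to be stable under averaging. `(1 + √2) + 1 = √2 (1 +
√2)` handles the vector, `(1 + δ) + δ + 1 = 2 (1 + δ)` the squared ℓ₂ norm, and `3δ + δ ≤ 3√2 δ` the
functional. Only `R` shrinks. -/
theorem isControlled_child {S : EllTwo →L[ℝ] EllInfty} {V : Submodule ℝ EllTwo} {δ R : ℝ}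
    (hδ : 0 < δ) {u q : EllOne × EllInfty} {k h : EllTwo} (hk : k ∈ V) (hh : h ∈ V)
    (hu1 : ‖u.1‖ ≤ (1 + √2) * (1 + δ) + R) (hk1 : ‖k‖ ^ 2 ≤ 1 + δ)
    (hu2 : ‖u.2 - S k‖ ≤ 3 * δ + R) (hh1 : ‖h‖ = 1) (hin : |inner ℝ k h| ≤ δ / 2)
    (hq1 : ‖q.1‖ ≤ 1 + δ) (hq2 : ‖q.2 - S h‖ ≤ δ) :
    IsControlled S V δ ((√2)⁻¹ * R) ((√2)⁻¹ • (u + q)) := by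
  have h2 : √2 * √2 = 2 := Real.mul_self_sqrt zero_le_two
  have h20 : 0 < √2 := Real.sqrt_pos.2 two_pos
  have hinv : ‖(√2)⁻¹‖ = (√2)⁻¹ := Real.norm_of_nonneg (inv_nonneg.2 h20.le)
  refine ⟨?_, (√2)⁻¹ • (k + h), V.smul_mem _ (V.add_mem hk hh), ?_, ?_⟩
  · rw [Prod.smul_fst, Prod.fst_add, norm_smul, hinv, inv_mul_le_iff₀ h20]
    refine (norm_add_le _ _).trans ?_
    have : √2 * ((1 + √2) * (1 + δ) + (√2)⁻¹ * R) = (√2 + √2 * √2) * (1 + δ) + R := by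
      field_simp
    rw [this, h2]
    linarith
  · have e : (√2)⁻¹ ^ 2 = 1 / 2 := by
      rw [inv_pow, Real.sq_sqrt zero_le_two, one_div]
    rw [norm_smul, hinv, mul_pow, e, norm_add_sq_real, hh1]
    have := (abs_le.1 hin).2
    linarith
  · have : ((√2)⁻¹ • (u + q)).2 - S ((√2)⁻¹ • (k + h))
        = (√2)⁻¹ • ((u.2 - S k) + (q.2 - S h)) := by
      rw [map_smul, map_add, Prod.smul_snd, Prod.snd_add, ← smul_sub]
      congr 1
      abel
    rw [this, norm_smul, hinv, inv_mul_le_iff₀ h20]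
    refine (norm_add_le _ _).trans ?_
    have : √2 * (3 * δ + (√2)⁻¹ * R) = 3 * √2 * δ + R := by
      field_simp
    rw [this]
    have h43 : 4 / 3 ≤ √2 := Real.le_sqrt_of_sq_le (by norm_num)
    nlinarith

/-- The standing data: an almost biorthogonal sequence over an orthonormal sequence. -/
structure SpreadingData (S : EllTwo →L[ℝ] EllInfty) (V : Submodule ℝ EllTwo) (h : ℕ → EllTwo)
    (l : Filter ℕ) (y : ℕ → EllInfty) (g : ℕ → EllOne) : Prop where
  orthonormal : Orthonormal ℝ h
  mem : ∀ n, h n ∈ V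
  le_atTop : l ≤ atTop
  almost : AlmostBiorthogonal l (fun n => S (h n)) y g

/-- A controlled pair over a finite biorthogonal system splits into two controlled pairs with
excess smaller by the factor `√2`. -/
theorem SpreadingData.exists_split {S : EllTwo →L[ℝ] EllInfty} {V : Submodule ℝ EllTwo}
    {h : ℕ → EllTwo} {l : Filter ℕ} [l.NeBot] {y : ℕ → EllInfty} {g : ℕ → EllOne}
    (D : SpreadingData S V h l y g) {δ R : ℝ} (hδ : 0 < δ) {A : Finset (EllOne × EllInfty)}
    {u : EllOne × EllInfty} (hA : IsBiorthogonalSet (A : Set (EllOne × EllInfty)))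
    (hAn : ∀ p ∈ A, p.2 ∈ nullFunctionals l g) (hun : u.2 ∈ nullFunctionals l g)
    (hu : pairing u.2 u.1 = 1) (hAu : ∀ p ∈ A, MutuallyOrthogonal p u)
    (hc : IsControlled S V δ R u) :
    ∃ b c : EllOne × EllInfty, u.1 = (√2)⁻¹ • (b.1 + c.1) ∧ MutuallyOrthogonal c b ∧
      (pairing b.2 b.1 = 1 ∧ b.2 ∈ nullFunctionals l g ∧ (∀ p ∈ A, MutuallyOrthogonal p b) ∧
        IsControlled S V δ ((√2)⁻¹ * R) b) ∧
      (pairing c.2 c.1 = 1 ∧ c.2 ∈ nullFunctionals l g ∧ (∀ p ∈ A, MutuallyOrthogonal p c) ∧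
        IsControlled S V δ ((√2)⁻¹ * R) c) := by
  classical
  obtain ⟨hu1, k, hk, hk1, hu2⟩ := hc
  have hin : ∀ᶠ n in l, |inner ℝ k (h n)| ≤ δ / 2 := by
    have h1 := (tendsto_apply_of_orthonormal D.orthonormal
      (InnerProductSpace.toDual ℝ EllTwo k)).mono_left D.le_atTop
    have h2 := h1.abs.eventually (gt_mem_nhds (show |(0 : ℝ)| < δ / 2 by simpa using hδ))
    filter_upwards [h2] with n hn
    simpa using hn.le
  -- Including `u` makes the fresh pair biorthogonal to `u` too, as the rotation requires.
  have hAu' : IsBiorthogonalSet ((insert u A : Finset _) : Set (EllOne × EllInfty)) := by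
    rw [Finset.coe_insert]
    exact hA.insert hu hAu
  obtain ⟨n, q, hn, hqq, hq, hqn, hq1, hq2⟩ := D.almost.exists_pair hAu'
    ((Finset.forall_mem_insert _ _ _).2 ⟨hun, hAn⟩) hδ hin
  obtain ⟨huq, hAq⟩ := Finset.forall_mem_insert _ _ _ |>.1 hq
  have e2 : (√2)⁻¹ * (√2)⁻¹ = 1 / 2 := by
    rw [← mul_inv, Real.mul_self_sqrt zero_le_two, one_div]
  set b := (√2)⁻¹ • (u + q) with hb
  set c := (√2)⁻¹ • (u + -q) with hc
  have hbC : IsControlled S V δ ((√2)⁻¹ * R) b :=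
    isControlled_child hδ hk (D.mem n) hu1 hk1 hu2 (D.orthonormal.1 n) hn hq1 hq2
  have hcC : IsControlled S V δ ((√2)⁻¹ * R) c := by
    refine isControlled_child hδ hk (V.neg_mem (D.mem n)) hu1 hk1 hu2
      (by simpa using D.orthonormal.1 n) (by simpa using hn) (by simpa using hq1) ?_
    rw [map_neg, Prod.snd_neg, ← neg_sub', norm_neg]
    exact hq2
  have hbn : b.2 ∈ nullFunctionals l g :=
    Submodule.smul_mem _ _ (Submodule.add_mem _ hun hqn)
  have hcn : c.2 ∈ nullFunctionals l g :=
    Submodule.smul_mem _ _ (Submodule.add_mem _ hun (Submodule.neg_mem _ hqn))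
  have hu' : u.1 = (√2)⁻¹ • (b.1 + c.1) := by
    have : b.1 + c.1 = (2 * (√2)⁻¹) • u.1 := by
      simp only [hb, hc, Prod.smul_fst, Prod.fst_add, Prod.fst_neg]
      module
    rw [this, smul_smul, show (√2)⁻¹ * (2 * (√2)⁻¹) = 1 by linear_combination 2 * e2, one_smul]
  have hbb : pairing b.2 b.1 = 1 := pairing_smul_add e2 hu hqq huq
  have hcc : pairing c.2 c.1 = 1 :=
    pairing_smul_add e2 hu (by simpa using hqq) huq.neg
  have hcb : MutuallyOrthogonal c b := mutuallyOrthogonal_sub_add _ hu hqq huq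
  have hAb : ∀ p ∈ A, MutuallyOrthogonal p b := fun p hp => ((hAu p hp).add (hAq p hp)).smul _
  have hAc : ∀ p ∈ A, MutuallyOrthogonal p c :=
    fun p hp => ((hAu p hp).add (hAq p hp).neg).smul _
  exact ⟨b, c, hu', hcb, ⟨hbb, hbn, hAb, hbC⟩, hcc, hcn, hAc, hcC⟩

/-- A pair in a finite biorthogonal system can be replaced by finitely many controlled pairs with a
geometrically smaller excess, without shrinking the span of the vectors. -/
theorem SpreadingData.exists_spread {S : EllTwo →L[ℝ] EllInfty} {V : Submodule ℝ EllTwo}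
    {h : ℕ → EllTwo} {l : Filter ℕ} [l.NeBot] {y : ℕ → EllInfty} {g : ℕ → EllOne}
    (D : SpreadingData S V h l y g) {δ : ℝ} (hδ : 0 < δ) (m : ℕ) :
    ∀ (R : ℝ) (A : Finset (EllOne × EllInfty)) (u : EllOne × EllInfty),
      IsBiorthogonalSet (A : Set (EllOne × EllInfty)) →
      (∀ p ∈ A, p.2 ∈ nullFunctionals l g) → u.2 ∈ nullFunctionals l g →
      pairing u.2 u.1 = 1 → (∀ p ∈ A, MutuallyOrthogonal p u) → IsControlled S V δ R u →
      ∃ L : Finset (EllOne × EllInfty), IsBiorthogonalSet (L : Set (EllOne × EllInfty)) ∧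
        (∀ p ∈ A, ∀ q ∈ L, MutuallyOrthogonal p q) ∧ (∀ p ∈ L, p.2 ∈ nullFunctionals l g) ∧
        (∀ p ∈ L, IsControlled S V δ ((√2)⁻¹ ^ m * R) p) ∧
        u.1 ∈ Submodule.span ℝ (Prod.fst '' (L : Set (EllOne × EllInfty))) := by
  classical
  induction m with
  | zero =>
    intro R A u hA hAn hun hu hAu hc
    refine ⟨{u}, by simpa using isBiorthogonalSet_singleton hu, by simpa using hAu,
      by simpa using hun, by simpa using hc, by simp⟩
  | succ m ih =>
    intro R A u hA hAn hun hu hAu hc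
    obtain ⟨b, c, hu', hcb, ⟨hbb, hbn, hAb, hbC⟩, hcc, hcn, hAc, hcC⟩ :=
      D.exists_split hδ hA hAn hun hu hAu hc
    -- While `b` is spread, `c` counts as part of the system; so `c` stays orthogonal to `B` and can
    -- then be spread over `A ∪ B`.
    obtain ⟨B, hB, hAB, hBn, hBC, hbB⟩ := ih ((√2)⁻¹ * R) (insert c A) b
      (by
        rw [Finset.coe_insert]
        exact hA.insert hcc hAc)
      ((Finset.forall_mem_insert _ _ _).2 ⟨hcn, hAn⟩) hbn hbb
      ((Finset.forall_mem_insert _ _ _).2 ⟨hcb, hAb⟩) hbC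
    obtain ⟨hcB, hAB⟩ := Finset.forall_mem_insert _ _ _ |>.1 hAB
    obtain ⟨C, hC, hABC, hCn, hCC, hcC'⟩ := ih ((√2)⁻¹ * R) (A ∪ B) c
      (by rw [Finset.coe_union]; exact hA.union hB hAB)
      (by
        intro p hp
        rcases Finset.mem_union.1 hp with hp | hp
        exacts [hAn p hp, hBn p hp]) hcn hcc
      (by
        intro p hp
        rcases Finset.mem_union.1 hp with hp | hp
        exacts [hAc p hp, (hcB p hp).symm]) hcC
    refine ⟨B ∪ C, ?_, ?_, ?_, ?_, ?_⟩
    · rw [Finset.coe_union]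
      exact hB.union hC fun p hp q hq => hABC p (Finset.mem_union_right _ hp) q hq
    · intro p hp q hq
      rcases Finset.mem_union.1 hq with hq | hq
      exacts [hAB p hp q hq, hABC p (Finset.mem_union_left _ hp) q hq]
    · intro p hp
      rcases Finset.mem_union.1 hp with hp | hp
      exacts [hBn p hp, hCn p hp]
    · intro p hp
      rw [pow_succ, mul_assoc]
      rcases Finset.mem_union.1 hp with hp | hp
      exacts [hBC p hp, hCC p hp]
    · rw [hu', Finset.coe_union, Set.image_union]
      exact Submodule.smul_mem _ _ (Submodule.add_mem _
        (Submodule.span_mono Set.subset_union_left hbB)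
        (Submodule.span_mono Set.subset_union_right hcC'))

/-! ### Exhausting ℓ₁ -/

/-- A finite biorthogonal system of controlled pairs with functionals null along `g`. -/
structure IsControlledSystem (S : EllTwo →L[ℝ] EllInfty) (V : Submodule ℝ EllTwo) (l : Filter ℕ)
    (g : ℕ → EllOne) (δ : ℝ) (A : Finset (EllOne × EllInfty)) : Prop where
  biorthogonal : IsBiorthogonalSet (A : Set (EllOne × EllInfty))
  null : ∀ p ∈ A, p.2 ∈ nullFunctionals l g
  controlled : ∀ p ∈ A, IsControlled S V δ δ p

/-- The remainder of `x` modulo `A`, paired with the remainder of a scaled coordinate functional, is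
a pair with no useful norm bound. Spreading it often enough makes all its descendants good. -/
theorem SpreadingData.exists_extend {S : EllTwo →L[ℝ] EllInfty} {V : Submodule ℝ EllTwo}
    {h : ℕ → EllTwo} {l : Filter ℕ} [l.NeBot] {y : ℕ → EllInfty} {g : ℕ → EllOne}
    (D : SpreadingData S V h l y g) {δ : ℝ} (hδ : 0 < δ) {A : Finset (EllOne × EllInfty)}
    (hA : IsControlledSystem S V l g δ A) (x : EllOne) :
    ∃ B, A ⊆ B ∧ IsControlledSystem S V l g δ B ∧
      x ∈ Submodule.span ℝ (Prod.fst '' (B : Set (EllOne × EllInfty))) := by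
  classical
  have hsum : ∑ p ∈ A, pairing p.2 x • p.1 ∈
      Submodule.span ℝ (Prod.fst '' (A : Set (EllOne × EllInfty))) :=
    Submodule.sum_mem _ fun p hp =>
      Submodule.smul_mem _ _ (Submodule.subset_span ⟨p, hp, rfl⟩)
  have hx : x = vecRemainder A x + ∑ p ∈ A, pairing p.2 x • p.1 := by simp [vecRemainder]
  set v := vecRemainder A x with hv
  by_cases h0 : v = 0
  · refine ⟨A, subset_rfl, hA, ?_⟩
    rw [hx, h0, zero_add]
    exact hsum
  obtain ⟨i, hi⟩ : ∃ i, v i ≠ 0 := by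
    by_contra! hcon
    exact h0 (lp.ext (funext hcon))
  let f₀ : EllInfty := (v i)⁻¹ • lp.single ∞ i (1 : ℝ)
  have hf₀ : ∀ z : EllOne, pairing f₀ z = (v i)⁻¹ * z i := by
    intro z
    rw [map_smul, _root_.smul_apply, smul_eq_mul, pairing_apply, tsum_eq_single i]
    · simp
    · intro m hm
      simp [hm]
  have hf₀n : f₀ ∈ nullFunctionals l g := by
    rw [mem_nullFunctionals]
    simp only [hf₀]
    simpa using (D.almost.coord i).const_mul (v i)⁻¹
  set u : EllOne × EllInfty := (v, funRemainder A f₀) with hu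
  set R := max ‖u.1‖ ‖u.2‖
  obtain ⟨m, hm⟩ : ∃ m : ℕ, (√2)⁻¹ ^ m * R < δ := by
    have h1 : (√2)⁻¹ < 1 := inv_lt_one_of_one_lt₀ (Real.lt_sqrt_of_sq_lt (by norm_num))
    have h2 := (tendsto_pow_atTop_nhds_zero_of_lt_one (by positivity) h1).mul_const R
    rw [zero_mul] at h2
    exact (h2.eventually (gt_mem_nhds hδ)).exists
  obtain ⟨L, hL, hAL, hLn, hLC, huL⟩ := D.exists_spread hδ m R A u hA.biorthogonal hA.null
    (funRemainder_mem_nullFunctionals hA.null hf₀n)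
    (by
      rw [hu, hv, pairing_funRemainder_vecRemainder hA.biorthogonal, ← hv, hf₀,
        inv_mul_cancel₀ hi])
    (fun p hp => ⟨pairing_mem_vecRemainder hA.biorthogonal hp x,
      pairing_funRemainder_mem hA.biorthogonal hp f₀⟩)
    (by
      refine ⟨?_, 0, V.zero_mem, by simp; linarith, ?_⟩
      · have : ‖u.1‖ ≤ R := le_max_left _ _
        have : 0 ≤ (1 + √2) * (1 + δ) := by positivity
        linarith
      · have : ‖u.2‖ ≤ R := le_max_right _ _
        rw [map_zero, sub_zero]
        linarith)
  refine ⟨A ∪ L, Finset.subset_union_left, ⟨?_, ?_, ?_⟩, ?_⟩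
  · rw [Finset.coe_union]
    exact hA.biorthogonal.union hL hAL
  · intro p hp
    rcases Finset.mem_union.1 hp with hp | hp
    exacts [hA.null p hp, hLn p hp]
  · intro p hp
    rcases Finset.mem_union.1 hp with hp | hp
    exacts [hA.controlled p hp, (hLC p hp).mono hm.le]
  · rw [hx, Finset.coe_union, Set.image_union]
    exact Submodule.add_mem _ (Submodule.span_mono Set.subset_union_right huL)
      (Submodule.span_mono Set.subset_union_left hsum)

theorem IsIsomorphicWith.exists_embedding {τ : ℝ} {Z : Submodule ℝ EllInfty}
    (hZ : IsIsomorphicWith τ Z EllTwo) :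
    ∃ (S : EllTwo →L[ℝ] EllInfty) (κ : ℝ), 0 < κ ∧ (∀ h, S h ∈ Z) ∧ ∀ h, κ * ‖h‖ ≤ ‖S h‖ := by
  obtain ⟨T, a, b, ha, -, hsurj, hT⟩ := hZ
  have hinj : Function.Injective T := by
    refine (injective_iff_map_eq_zero T).2 fun z hz => ?_
    have h1 := (hT z).1
    rw [hz, norm_zero] at h1
    have h2 : 0 < a⁻¹ := inv_pos.2 ha
    exact norm_le_zero_iff.1 (nonpos_of_mul_nonpos_right h1 h2)
  let e : Z ≃ₗ[ℝ] EllTwo := LinearEquiv.ofBijective T.toLinearMap ⟨hinj, hsurj⟩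
  have he : ∀ h, T (e.symm h) = h := fun h => e.apply_symm_apply h
  let S₀ : EllTwo →L[ℝ] Z := e.symm.toLinearMap.mkContinuous a fun h => by
    have h1 := (hT (e.symm h)).1
    rw [he, inv_mul_le_iff₀ ha] at h1
    exact h1
  have hb : 0 < max b 1 := lt_max_of_lt_right one_pos
  refine ⟨Z.subtypeL.comp S₀, (max b 1)⁻¹, inv_pos.2 hb, fun h => (S₀ h).2, fun h => ?_⟩
  rw [inv_mul_le_iff₀ hb]
  have h1 := (hT (e.symm h)).2
  rw [he] at h1
  exact h1.trans (mul_le_mul_of_nonneg_right (le_max_left _ _) (norm_nonneg _))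

/-- Exhausting the unit vectors of `ℓ₁` yields a countably infinite biorthogonal set of controlled
pairs whose vectors span all unit vectors. -/
theorem SpreadingData.exists_sequence {S : EllTwo →L[ℝ] EllInfty} {V : Submodule ℝ EllTwo}
    {h : ℕ → EllTwo} {l : Filter ℕ} [l.NeBot] {y : ℕ → EllInfty} {g : ℕ → EllOne}
    (D : SpreadingData S V h l y g) {δ : ℝ} (hδ : 0 < δ) :
    ∃ p : ℕ → EllOne × EllInfty, (∀ n, IsControlled S V δ δ (p n)) ∧
      (∀ n m, pairing (p n).2 (p m).1 = if n = m then 1 else 0) ∧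
      ∀ i, lp.single 1 i (1 : ℝ) ∈ Submodule.span ℝ (Set.range fun n => (p n).1) := by
  classical
  choose next hsub hnext hspan using
    fun (A : {A // IsControlledSystem S V l g δ A}) (x : EllOne) => D.exists_extend hδ A.2 x
  let F : ℕ → {A // IsControlledSystem S V l g δ A} := fun n => Nat.rec
    ⟨∅, ⟨by simp [IsBiorthogonalSet], by simp, by simp⟩⟩
    (fun n A => ⟨next A (lp.single 1 n (1 : ℝ)), hnext A _⟩) n
  have hmono : Monotone fun n => (F n).1 := monotone_nat_of_le_succ fun n => hsub (F n) _
  let U : Set (EllOne × EllInfty) := ⋃ n, ((F n).1 : Set (EllOne × EllInfty))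
  have hUm : ∀ {q}, q ∈ U ↔ ∃ n, q ∈ (F n).1 := by simp [U]
  have hU : IsBiorthogonalSet U := by
    refine ⟨fun q hq => ?_, fun q hq r hr hne => ?_⟩
    · obtain ⟨n, hn⟩ := hUm.1 hq
      exact (F n).2.biorthogonal.1 q hn
    · obtain ⟨n, hn⟩ := hUm.1 hq
      obtain ⟨m, hm⟩ := hUm.1 hr
      exact (F (max n m)).2.biorthogonal.2 (hmono (le_max_left n m) hn)
        (hmono (le_max_right n m) hm) hne
  have hUs : ∀ i, lp.single 1 i (1 : ℝ) ∈ Submodule.span ℝ (Prod.fst '' U) := fun i =>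
    Submodule.span_mono (Set.image_mono (Set.subset_iUnion
      (fun n => ((F n).1 : Set (EllOne × EllInfty))) (i + 1))) (hspan (F i) _)
  have hinf : U.Infinite := by
    intro hfin
    obtain ⟨A, hA⟩ := hfin.exists_finset_coe
    obtain ⟨-, q, -, hqq, hq, -⟩ := D.almost.exists_pair (A := A) (hA ▸ hU) (fun r hr => by
      obtain ⟨n, hn⟩ := hUm.1 (hA ▸ Finset.mem_coe.2 hr)
      exact (F n).2.null r hn) hδ (Filter.Eventually.of_forall fun _ => trivial)
    have hle : Submodule.span ℝ (Prod.fst '' U) ≤ LinearMap.ker (pairing q.2).toLinearMap := by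
      rw [Submodule.span_le]
      rintro _ ⟨r, hr, rfl⟩
      exact (hq r (Finset.mem_coe.1 (hA ▸ hr))).2
    have hq0 : q.2 = 0 := lp.ext (funext fun i => by
      rw [← pairing_single]
      exact hle (hUs i))
    simp [hq0] at hqq
  have : Infinite U := hinf.to_subtype
  have : Countable U := (Set.countable_iUnion fun n => (F n).1.countable_toSet).to_subtype
  obtain ⟨e⟩ : Nonempty (ℕ ≃ U) := nonempty_equiv_of_countable
  refine ⟨fun n => (e n : EllOne × EllInfty), fun n => ?_, fun n m => ?_, fun i => ?_⟩
  · obtain ⟨k, hk⟩ := hUm.1 (e n).2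
    exact (F k).2.controlled _ hk
  · split_ifs with hnm
    · rw [hnm]
      exact hU.1 _ (e m).2
    · exact (hU.2 (e n).2 (e m).2 fun heq => hnm (e.injective (Subtype.ext heq))).1
  · have : (Set.range fun n => (e n : EllOne × EllInfty).1) = Prod.fst '' U := by
      rw [← Function.comp_def Prod.fst, Set.range_comp, ← Function.comp_def Subtype.val,
        Set.range_comp, e.range_eq_univ, Set.image_univ, Subtype.range_coe]
    rw [this]
    exact hUs i

theorem isFundamental_of_single_mem_span {s : Set EllOne}
    (hs : ∀ i, lp.single 1 i (1 : ℝ) ∈ Submodule.span ℝ s) : IsFundamental s := by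
  refine (Submodule.eq_top_iff').2 fun x => ?_
  have h := lp.hasSum_single (p := 1) (by simp) x
  refine (Submodule.isClosed_topologicalClosure _).mem_of_tendsto h
    (Filter.Eventually.of_forall fun t => Submodule.sum_mem _ fun i _ =>
      Submodule.le_topologicalClosure _ ?_)
  have : lp.single (E := fun _ : ℕ => ℝ) 1 i (x i) = x i • lp.single 1 i (1 : ℝ) := by
    rw [← lp.single_smul]
    simp
  rw [this]
  exact Submodule.smul_mem _ _ (hs i)

theorem IsControlled.bounds {S : EllTwo →L[ℝ] EllInfty} {V : Submodule ℝ EllTwo} {δ : ℝ}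
    (hδ : 0 < δ) (hδ1 : δ ≤ 1) (hV : ∀ k ∈ V, ‖S k‖ ≤ (1 + δ) * ‖k‖)
    {u : EllOne × EllInfty} (hu : IsControlled S V δ δ u) :
    ‖u.1‖ ≤ 1 + √2 + 4 * δ ∧ ‖u.2‖ ≤ 1 + 7 * δ ∧ ∃ k, ‖u.2 - S k‖ ≤ 4 * δ := by
  obtain ⟨h1, k, hk, hk1, h2⟩ := hu
  have hs : √2 ≤ 2 := Real.sqrt_le_iff.2 ⟨by norm_num, by norm_num⟩
  refine ⟨by nlinarith, ?_, k, by linarith⟩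
  have hk2 : ‖k‖ ≤ 1 + δ := by
    refine abs_le_of_sq_le_sq' (hk1.trans ?_) (by linarith) |>.2
    nlinarith
  have h3 : ‖S k‖ ≤ (1 + δ) * (1 + δ) := (hV k hk).trans (by gcongr)
  have h4 : ‖u.2‖ ≤ ‖S k‖ + ‖u.2 - S k‖ := norm_le_norm_add_norm_sub' _ _
  nlinarith

end BiorthogonalSystems

theorem corollary5p1 (ε η : ℝ) (hε : 0 < ε) (hη : 0 < η)
    (Z₁ Z₂ : Submodule ℝ EllInfty)
    (hZ₁_total : IsTotalSet (ellInftyEquivDual '' (Z₁ : Set EllInfty)))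
    (hZ₁ : Nonempty (Z₁ ≃L[ℝ] LOne))
    (hZ₂_le : Z₂ ≤ Z₁)
    (hZ₂ : IsIsomorphicWith (1 + η) Z₂ EllTwo) :
    ∃ (x : ℕ → EllOne) (xs : ℕ → EllInfty),
      (∀ n, x n ∈ Metric.sphere (0 : EllOne) 1) ∧
      IsBiorthogonal x (fun n => ellInftyEquivDual (xs n)) ∧
      IsBoundedBy ((1 + Real.sqrt 2) + ε) x (fun n => ellInftyEquivDual (xs n)) ∧
      IsFundamental (Set.range x) ∧
      (⨆ n, Metric.infEDist (xs n) (Z₂ : Set EllInfty)) < ENNReal.ofReal η := by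
  obtain ⟨S₀, κ, hκ, hS₀Z, hS₀⟩ := hZ₂.exists_embedding
  obtain ⟨δ, hδ, hδ1, hδε, hδη⟩ : ∃ δ : ℝ, 0 < δ ∧ δ ≤ 1 ∧ 60 * δ ≤ ε ∧ 60 * δ ≤ η := by
    refine ⟨min 1 (min (ε / 60) (η / 60)), by positivity, min_le_left _ _, ?_, ?_⟩
    · have : min 1 (min (ε / 60) (η / 60)) ≤ ε / 60 := (min_le_right _ _).trans (min_le_left _ _)
      linarith
    · have : min 1 (min (ε / 60) (η / 60)) ≤ η / 60 := (min_le_right _ _).trans (min_le_right _ _)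
      linarith
  obtain ⟨t, V, h, ho, hhV, hV, hh1⟩ := exists_orthonormal_almost_norming S₀ hκ hS₀ hδ hδ1
  obtain ⟨l, y, g, hl, H⟩ := exists_almostBiorthogonal (t • S₀) ho hh1
  have D : SpreadingData (t • S₀) V h l y g := ⟨ho, hhV, hl, H⟩
  obtain ⟨p, hpc, hpb, hps⟩ := D.exists_sequence hδ
  have hs : √2 ≤ 2 := Real.sqrt_le_iff.2 ⟨by norm_num, by norm_num⟩
  have hpos : ∀ n, 0 < ‖(p n).1‖ := by
    intro n
    rw [norm_pos_iff]
    intro h0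
    have := hpb n n
    simp [h0] at this
  have hx1 : ∀ n, ‖‖(p n).1‖⁻¹ • (p n).1‖ = 1 := fun n => by
    rw [norm_smul, norm_inv, norm_norm, inv_mul_cancel₀ (hpos n).ne']
  have hf : ∀ n, ‖ellInftyEquivDual (‖(p n).1‖ • (p n).2)‖ ≤ 1 + √2 + ε := by
    intro n
    obtain ⟨h1, h2, -⟩ := (hpc n).bounds hδ hδ1 hV
    rw [LinearIsometryEquiv.norm_map, norm_smul, norm_norm]
    calc ‖(p n).1‖ * ‖(p n).2‖ ≤ (1 + √2 + 4 * δ) * (1 + 7 * δ) := by gcongr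
      _ ≤ 1 + √2 + 60 * δ := by nlinarith
      _ ≤ 1 + √2 + ε := by linarith
  refine ⟨fun n => ‖(p n).1‖⁻¹ • (p n).1, fun n => ‖(p n).1‖ • (p n).2, fun n => ?_,
    fun n m => ?_, ⟨?_, ?_, fun n => ?_⟩, ?_, ?_⟩
  · simpa using hx1 n
  · change pairing (‖(p n).1‖ • (p n).2) (‖(p m).1‖⁻¹ • (p m).1) = _
    rw [map_smul, map_smul, smul_apply, hpb]
    split_ifs with hnm
    · rw [hnm, smul_eq_mul, smul_eq_mul, mul_one, inv_mul_cancel₀ (hpos m).ne']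
    · simp
  · rw [isBounded_iff_forall_norm_le]
    exact ⟨1, by rintro _ ⟨n, rfl⟩; exact (hx1 n).le⟩
  · rw [isBounded_iff_forall_norm_le]
    exact ⟨1 + √2 + ε, by rintro _ ⟨n, rfl⟩; exact hf n⟩
  · rw [hx1, one_mul]
    exact hf n
  · refine isFundamental_of_single_mem_span fun i => ?_
    refine Submodule.span_le.2 ?_ (hps i)
    rintro _ ⟨n, rfl⟩
    have hm : ‖(p n).1‖ • ‖(p n).1‖⁻¹ • (p n).1 ∈
        Submodule.span ℝ (Set.range fun n => ‖(p n).1‖⁻¹ • (p n).1) :=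
      Submodule.smul_mem _ _ (Submodule.subset_span ⟨n, rfl⟩)
    rwa [smul_smul, mul_inv_cancel₀ (hpos n).ne', one_smul] at hm
  · refine lt_of_le_of_lt (b := ENNReal.ofReal (28 * δ)) (iSup_le fun n => ?_)
      ((ENNReal.ofReal_lt_ofReal_iff hη).2 (by linarith))
    obtain ⟨h1, -, k, hk⟩ := (hpc n).bounds hδ hδ1 hV
    have hmem : ‖(p n).1‖ • (t • S₀) k ∈ (Z₂ : Set EllInfty) :=
      Z₂.smul_mem _ (Z₂.smul_mem _ (hS₀Z k))
    refine (Metric.infEDist_le_edist_of_mem hmem).trans ?_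
    rw [edist_dist, dist_eq_norm, ← smul_sub, norm_smul, norm_norm]
    refine ENNReal.ofReal_le_ofReal ?_
    calc ‖(p n).1‖ * ‖(p n).2 - (t • S₀) k‖ ≤ 7 * (4 * δ) := by
          gcongr
          linarith
      _ = 28 * δ := by ring
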